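/- **Notation.** For $x=(x_0,\dots,x_{n-1})\in\mathbb Z_2^n$, identify $x$ with the integer $x_02^{n-1}+x_12^{n-2}+\dots+x_{n-1}$ (so $x_0$ is the most significant bit), and let $x+y$ denote addition modulo $2^n$. Let $x\oplus y$ be the coordinatewise sum modulo 2, $x\lll r=(x_r,\dots,x_{n-1},x_0,\dots,x_{r-1})$, and let $x\|y$ be concatenation. For $\alpha,\beta,\gamma\in\mathbb Z_2^n$ and $f_r(x,y)=(x\oplus y)\lll r$ put $$\mathrm{adp}^{\mathrm{XR}}(\alpha,\beta\xrightarrow{r}\gamma)=4^{-n}\,\#\{(x,y)\in\mathbb Z_2^n\times\mathbb Z_2^n : f_r(x+\alpha,y+\beta)=f_r(x,y)+\gamma\}.$$ The octal word $\omega(\alpha,\beta,\gamma)\in\{0,\dots,7\}^n$ has the symbols $\omega_i=4\alpha_i+2\beta_i+\gamma_i$, $i=0,\dots,n-1$. **Patterns.** A pattern $\mathtt{[}\cdots\mathtt{]}$ is a sequence of pattern symbols, to be matched by the whole word $\omega_0\omega_1\cdots\omega_{n-1}$ (most significant symbol first). The pattern symbols are: an octal digit (matches itself); $.$ (any octal symbol);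 $\mathtt e$ ($0,3,5,6$); $\mathtt d$ ($1,2,4,7$); $\hat t$ ($t$, $t\oplus3$, $t\oplus5$, with $\oplus$ the bitwise XOR of 3-bit numbers); $\alpha_0$ ($0,1,2,3$); $\beta_0$ ($0,1,4,5$); $\gamma_0$ ($0,2,4,6$); $\gamma_1$ ($1,3,5,7$); $0_6$ ($0,6$); $1_7$ ($1,7$). For a symbol $s$, $s*$ matches any finite, possibly empty, sequence of octal symbols each of which matches $s$. **Table.** Each of the seven columns $X$ has a mark and a list of elements $X.1, X.2,\dots$: 1. mark $[.{*}\,\mathtt d\,0\,0{*}]$; elements $[\alpha_0{*}]$, $[\beta_0{*}]$, $[0\hat0{*}]$, $[0\hat0{*}1.{*}]$, $[0\hat0{*}2\alpha_0{*}]$, $[0\hat0{*}4\beta_0{*}]$, $[0\hat0{*}7]$, $[0\hat0{*}7\gamma_1{*}1_7]$, $[1\hat1{*}]$, $[1\hat1{*}0.{*}]$, $[1\hat1{*}3\alpha_0{*}]$, $[1\hat1{*}5\beta_0{*}]$, $[1\hat1{*}6]$, $[1\hat1{*}6\gamma_0{*}0_6]$. 2. mark $[.{*}\,\mathtt e\,2\,2{*}]$;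 elements $[\alpha_0{*}]$, $[2\hat2{*}]$, $[2\hat2{*}3.{*}]$, $[2\hat2{*}0\alpha_0{*}]$, $[2\hat2{*}5\gamma_1{*}1_7]$, $[3\hat3{*}]$, $[3\hat3{*}2.{*}]$, $[3\hat3{*}1\alpha_0{*}]$, $[3\hat3{*}4\gamma_0{*}0_6]$. 3. mark $[.{*}\,\mathtt e\,4\,4{*}]$; elements $[\beta_0{*}]$, $[4\hat4{*}]$, $[4\hat4{*}5.{*}]$, $[4\hat4{*}0\beta_0{*}]$, $[4\hat4{*}3\gamma_1{*}1_7]$, $[5\hat5{*}]$, $[5\hat5{*}4.{*}]$, $[5\hat5{*}1\beta_0{*}]$, $[5\hat5{*}2\gamma_0{*}0_6]$. 4. mark $[.{*}\,\mathtt d\,6\,6{*}]$; elements $[6\hat6{*}7.{*}]$, $[6\hat6{*}1\gamma_1{*}1_7]$, $[7\hat7{*}6.{*}]$, $[7\hat7{*}0\gamma_0{*}0_6]$. 5. mark $[.{*}\,\mathtt d]$; elements $[0{*}]$, $[1{*}]$. 6. mark $[.{*}]$; elements $[.{*}\,\mathtt d\,0\,0{*}]$, $[.{*}\,\mathtt e\,1\,1{*}]$.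 7. mark $[\gamma_0{*}]$; element $[.{*}\,\mathtt d]$. A pair of octal words $(\omega,\omega')$ satisfies the pattern $X.Y$ if $\omega'$ satisfies the mark of column $X$ and $\omega$ satisfies the $Y$-th element of column $X$. **Theorem.** Let $1\le r\le n-1$, $\alpha,\beta,\gamma\in\mathbb Z_2^{n-r}$ and $\alpha',\beta',\gamma'\in\mathbb Z_2^{r}$. Then $$\mathrm{adp}^{\mathrm{XR}}(\alpha'\|\alpha,\ \beta'\|\beta\xrightarrow{r}\gamma\|\gamma')=0$$ if and only if the pair $(\omega(\alpha,\beta,\gamma),\,\omega(\alpha',\beta',\gamma'))$ satisfies some pattern $X.Y$ of the table. -/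

import Mathlib

namespace ImpossibleXR

/-! Binary vectors of length `n` are `BitVec n`; coordinate `0` of the text is the most significant
bit, `BitVec.getMsb _ 0`.  Addition of bit vectors is addition modulo `2 ^ n`, `^^^` is the bitwise
XOR, `++` is concatenation (its first argument holds the most significant bits), and
`BitVec.rotateLeft` is the cyclic rotation towards the most significant bit. -/

instance instFintypeBitVec (n : ℕ) : Fintype (BitVec n) :=
  Fintype.ofEquiv (Fin (2 ^ n)) BitVec.equivFin.toEquiv.symm

/-- The additive differential probability of `f : (ℤ₂ⁿ)ᵏ → ℤ₂ⁿ` with input differences `α` and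
output difference `γ`, the inputs of `f` being uniformly distributed. -/
def adp {n k : ℕ} (f : (Fin k → BitVec n) → BitVec n) (α : Fin k → BitVec n) (γ : BitVec n) : ℚ :=
  ((Finset.univ.filter fun x : Fin k → BitVec n =>
    f (fun i => x i + α i) = f x + γ).card : ℚ) / 2 ^ (k * n)

/-- The additive differential probability of the XR-operation `(x, y) ↦ (x ⊕ y) ⋘ r`. -/
def adpXR {n : ℕ} (r : ℕ) (α β γ : BitVec n) : ℚ :=
  adp (fun x : Fin 2 → BitVec n => (x 0 ^^^ x 1).rotateLeft r) ![α, β] γ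

/-! ### Octal words -/

/-- The octal symbol `4 a + 2 b + c`. -/
def octal (a b c : Bool) : Fin 8 :=
  ⟨4 * a.toNat + 2 * b.toNat + c.toNat, by cases a <;> cases b <;> cases c <;> decide⟩

/-- The octal word of three binary vectors, its symbols listed from the most significant one to the
least significant one. -/
def octalWord {n : ℕ} (α β γ : BitVec n) : List (Fin 8) :=
  List.ofFn fun i : Fin n => octal (α.getMsb i) (β.getMsb i) (γ.getMsb i)

/-! ### Patterns -/

/-- Patterns are regular expressions over the octal alphabet. -/
abbrev Pattern := RegularExpression (Fin 8)

/-- A whole word satisfies a pattern. -/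
def Satisfies (w : List (Fin 8)) (p : Pattern) : Prop := w ∈ p.matches'

/-- The pattern symbol matched by exactly the one-symbol words `s` with `s ∈ l`. -/
def oneOf (l : List (Fin 8)) : Pattern := (l.map RegularExpression.char).sum

/-- `s*`: any number of repetitions (possibly none) of `s`. -/
postfix:max "∗ₚ" => RegularExpression.star

/-- A fixed octal symbol. -/
def o (t : Fin 8) : Pattern := RegularExpression.char t

/-- The pattern symbol `.`. -/
def dot : Pattern := oneOf [0, 1, 2, 3, 4, 5, 6, 7]

/-- The pattern symbol `e` (symbols of even weight). -/
def e : Pattern := oneOf [0, 3, 5, 6]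

/-- The pattern symbol `d` (symbols of odd weight). -/
def d : Pattern := oneOf [1, 2, 4, 7]

/-- The pattern symbol `t` with a hat: `t`, `t ⊕ 3`, `t ⊕ 5`. -/
def hat (t : Fin 8) : Pattern := oneOf [t, t ^^^ 3, t ^^^ 5]

/-- The pattern symbol `α₀`. -/
def α₀ : Pattern := oneOf [0, 1, 2, 3]

/-- The pattern symbol `β₀`. -/
def β₀ : Pattern := oneOf [0, 1, 4, 5]

/-- The pattern symbol `γ₀`. -/
def γ₀ : Pattern := oneOf [0, 2, 4, 6]

/-- The pattern symbol `γ₁`. -/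
def γ₁ : Pattern := oneOf [1, 3, 5, 7]

/-- The pattern symbol `0₆`. -/
def zeroSix : Pattern := oneOf [0, 6]

/-- The pattern symbol `1₇`. -/
def oneSeven : Pattern := oneOf [1, 7]

/-- The table of the zero values: for every column its mark and the list of its elements. -/
def zeroTable : List (Pattern × List Pattern) :=
  [ -- column 1
    (dot∗ₚ * d * o 0 * (o 0)∗ₚ,
      [ α₀∗ₚ,
        β₀∗ₚ,
        o 0 * (hat 0)∗ₚ,
        o 0 * (hat 0)∗ₚ * o 1 * dot∗ₚ,
        o 0 * (hat 0)∗ₚ * o 2 * α₀∗ₚ,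
        o 0 * (hat 0)∗ₚ * o 4 * β₀∗ₚ,
        o 0 * (hat 0)∗ₚ * o 7,
        o 0 * (hat 0)∗ₚ * o 7 * γ₁∗ₚ * oneSeven,
        o 1 * (hat 1)∗ₚ,
        o 1 * (hat 1)∗ₚ * o 0 * dot∗ₚ,
        o 1 * (hat 1)∗ₚ * o 3 * α₀∗ₚ,
        o 1 * (hat 1)∗ₚ * o 5 * β₀∗ₚ,
        o 1 * (hat 1)∗ₚ * o 6,
        o 1 * (hat 1)∗ₚ * o 6 * γ₀∗ₚ * zeroSix ]),
    -- column 2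
    (dot∗ₚ * e * o 2 * (o 2)∗ₚ,
      [ α₀∗ₚ,
        o 2 * (hat 2)∗ₚ,
        o 2 * (hat 2)∗ₚ * o 3 * dot∗ₚ,
        o 2 * (hat 2)∗ₚ * o 0 * α₀∗ₚ,
        o 2 * (hat 2)∗ₚ * o 5 * γ₁∗ₚ * oneSeven,
        o 3 * (hat 3)∗ₚ,
        o 3 * (hat 3)∗ₚ * o 2 * dot∗ₚ,
        o 3 * (hat 3)∗ₚ * o 1 * α₀∗ₚ,
        o 3 * (hat 3)∗ₚ * o 4 * γ₀∗ₚ * zeroSix ]),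
    -- column 3
    (dot∗ₚ * e * o 4 * (o 4)∗ₚ,
      [ β₀∗ₚ,
        o 4 * (hat 4)∗ₚ,
        o 4 * (hat 4)∗ₚ * o 5 * dot∗ₚ,
        o 4 * (hat 4)∗ₚ * o 0 * β₀∗ₚ,
        o 4 * (hat 4)∗ₚ * o 3 * γ₁∗ₚ * oneSeven,
        o 5 * (hat 5)∗ₚ,
        o 5 * (hat 5)∗ₚ * o 4 * dot∗ₚ,
        o 5 * (hat 5)∗ₚ * o 1 * β₀∗ₚ,
        o 5 * (hat 5)∗ₚ * o 2 * γ₀∗ₚ * zeroSix ]),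
    -- column 4
    (dot∗ₚ * d * o 6 * (o 6)∗ₚ,
      [ o 6 * (hat 6)∗ₚ * o 7 * dot∗ₚ,
        o 6 * (hat 6)∗ₚ * o 1 * γ₁∗ₚ * oneSeven,
        o 7 * (hat 7)∗ₚ * o 6 * dot∗ₚ,
        o 7 * (hat 7)∗ₚ * o 0 * γ₀∗ₚ * zeroSix ]),
    -- column 5
    (dot∗ₚ * d,
      [ (o 0)∗ₚ,
        (o 1)∗ₚ ]),
    -- column 6
    (dot∗ₚ,
      [ dot∗ₚ * d * o 0 * (o 0)∗ₚ,
        dot∗ₚ * e * o 1 * (o 1)∗ₚ ]),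
    -- column 7
    (γ₀∗ₚ,
      [ dot∗ₚ * d ]) ]

/-- A pair of octal words satisfies some pattern `X.Y` of the table: `w'` satisfies the mark of the
column `X` and `w` satisfies the element of the column `X` in the row `Y`. -/
def SatisfiesTable (w w' : List (Fin 8)) : Prop :=
  ∃ X ∈ zeroTable, Satisfies w' X.1 ∧ ∃ Y ∈ X.2, Satisfies w Y

end ImpossibleXR

/-!
The differential equation is solved by following carries.  Write the two inputs as `x' ‖ x` and
`y' ‖ y`, where `x`, `y` are the `m` less significant bits.  After the rotation, the carries out of
`x + α` and `y + β` enter `x' + α'` and `y' + β'`, while the carry out of `(x' ⊕ y') + γ'` enters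
`(x ⊕ y) + γ`.  In each of the two words, what happens at a position depends only on the octal
symbol there and on the three carries coming from the right, so a word is read, from its least
significant symbol on, by a nondeterministic automaton with eight states, the triples of carries.
The probability is nonzero if and only if the two words have runs that exchange carries as just
described (`exists_differential_iff`, `adpXR_eq_zero_iff_carries`).

The table is then read as follows (columns counted from `0`).  The initial carry into `(x ⊕ y) + γ`
is the parity of the last symbol of `ω` (`CarryOut.eq_true_iff`); it is impossible if it is `1` and
`γ' = 0`, which is column `6`.  Otherwise the mark of a column `k ≤ 4` says that the carries
entering `ω'` must belong to the set `carryPairs k`; a word `ω'` without any of these marks admits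
exactly the two pairs of equal carries (`carryIn_iff`).  The elements of the column `k`, with those
of column `5`, are the words `ω` none of whose runs ends with a pair in `carryPairs k`; column `5`
itself, whose mark is no condition on `ω'`, lists the words without any runs
(`exists_carryOut_iff`).  A propositional argument combines these facts
(`forall_carryOut_not_carryIn_iff`).

These three facts compare the language of the carry automaton with languages given by patterns.
Both are regular, and the comparison is a finite one: sets of carries and sets of remaining
suffixes of patterns are updated symbol by symbol from the most significant symbol on, and a search
through all reachable pairs of such sets checks the claim in each of them
(`good_of_verifyPatterns`).
-/

namespace ImpossibleXR

/-! ### Verifying a property of all runs of a deterministic automaton -/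

/-- The value `f n`, defined by recursion on `n` so that evaluation by reduction replaces `n` by a
numeral before `f` copies it. -/
def callByValue (n : ℕ) (f : ℕ → Bool) : Bool := Nat.rec (f 0) (fun k _ => f (k + 1)) n

theorem callByValue_eq (n : ℕ) (f : ℕ → Bool) : callByValue n f = f n := by
  cases n <;> rfl

/-- The value `f l`, the entries of `l` being evaluated first. -/
def callByValueList : List ℕ → (List ℕ → Bool) → Bool
  | [], f => f []
  | a :: l, f => callByValue a fun a => callByValueList l fun l => f (a :: l)

theorem callByValueList_eq (l : List ℕ) (f : List ℕ → Bool) : callByValueList l f = f l := by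
  induction l generalizing f with
  | nil => rfl
  | cons a l ih => rw [callByValueList, callByValue_eq, ih]

/-- Depth-first search through the states reachable from those in the list `todo`, which
succeeds if it ends within `fuel` steps and every state found is good.  The states are
lists of numbers; `seen` lists those already visited. -/
def verify {A : Type*} (step : List ℕ → A → List ℕ) (letters : List A) (good : List ℕ → Bool) :
    (fuel : ℕ) → (todo seen : List (List ℕ)) → Bool
  | 0, _, _ => false
  | _ + 1, [], _ => true
  | n + 1, s :: todo, seen => callByValueList s fun s =>
    bif seen.contains s then verify step letters good n todo seen
    else good s && verify step letters good n (letters.map (step s) ++ todo) (s :: seen)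

/-- A successful search proves that the states it has visited are closed under the transitions. -/
theorem exists_invariant_of_verify {A : Type*} {step : List ℕ → A → List ℕ}
    {letters : List A} {good : List ℕ → Bool} (n : ℕ) (todo seen : List (List ℕ))
    (h : verify step letters good n todo seen = true)
    (hgood : ∀ s ∈ seen, good s = true)
    (hstep : ∀ s ∈ seen, ∀ a ∈ letters, step s a ∈ seen ∨ step s a ∈ todo) :
    ∃ I : Set (List ℕ), (∀ s ∈ seen, s ∈ I) ∧ (∀ s ∈ todo, s ∈ I) ∧ (∀ s ∈ I, good s = true) ∧
      ∀ s ∈ I, ∀ a ∈ letters, step s a ∈ I := by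
  induction n generalizing todo seen with
  | zero => simp [verify] at h
  | succ n ih =>
    cases todo with
    | nil => exact ⟨{s | s ∈ seen}, fun s hs => hs, by simp, hgood, by simpa using hstep⟩
    | cons s todo =>
      rw [verify, callByValueList_eq] at h
      cases hs : seen.contains s
      · rw [hs, cond_false, Bool.and_eq_true] at h
        obtain ⟨I, h1, h2, h3⟩ := ih _ (s :: seen) h.2 (by grind) (by grind)
        exact ⟨I, by grind, by grind, h3⟩
      · rw [hs, cond_true] at h
        rw [List.contains_iff_mem] at hs
        obtain ⟨I, h1, h2, h3⟩ := ih todo seen h hgood (by grind)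
        exact ⟨I, h1, by grind, h3⟩

theorem good_foldl_of_verify {A : Type*} {step : List ℕ → A → List ℕ}
    {letters : List A} (hletters : ∀ a, a ∈ letters) {good : List ℕ → Bool} {n : ℕ}
    {init : List ℕ} (h : verify step letters good n (letters.map (step init)) [] = true)
    {w : List A} (hw : w ≠ []) : good (w.foldl step init) = true := by
  obtain ⟨I, -, h1, h2, h3⟩ := exists_invariant_of_verify n _ _ h (by simp) (by simp)
  have hI (w : List A) (s : List ℕ) (hs : s ∈ I) : w.foldl step s ∈ I := by
    induction w generalizing s with
    | nil => exact hs
    | cons a w ih => exact ih _ (h3 s hs a (hletters a))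
  cases w with
  | nil => exact absurd rfl hw
  | cons a w => exact h2 _ (hI w _ (h1 _ (List.mem_map.2 ⟨a, hletters a, rfl⟩)))

/-! ### Recognizing patterns -/

/-- A factor of a pattern: a set of octal symbols, starred or not. -/
structure Factor where
  /-- The symbols matched. -/
  syms : List (Fin 8)
  /-- Whether any number of repetitions is allowed. -/
  starred : Bool

/-- The language of a sequence of factors. -/
def factorLang : List Factor → Language (Fin 8)
  | [] => 1
  | a :: l => (if a.starred then KStar.kstar (oneOf a.syms).matches' else (oneOf a.syms).matches') *
      factorLang l

/-- The symbols of a pattern that is a sum of symbols. -/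
def symbols? : Pattern → Option (List (Fin 8))
  | .zero => some []
  | .char t => some [t]
  | .plus p q => do return (← symbols? p) ++ (← symbols? q)
  | _ => none

/-- The factors of a pattern that is a product of possibly starred sums of symbols. -/
def factors? : Pattern → Option (List Factor)
  | .comp p q => do return (← factors? p) ++ (← factors? q)
  | .star p => do return [⟨← symbols? p, true⟩]
  | p => do return [⟨← symbols? p, false⟩]

theorem mem_matches'_oneOf (l : List (Fin 8)) (w : List (Fin 8)) :
    w ∈ (oneOf l).matches' ↔ ∃ t ∈ l, w = [t] := by
  induction l with
  | nil =>
    change w ∈ (0 : Language (Fin 8)) ↔ _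
    simp
  | cons a l ih =>
    have : oneOf (a :: l) = RegularExpression.char a + oneOf l := rfl
    rw [this, RegularExpression.matches'_add, Language.mem_add, ih]
    simp only [List.mem_cons, exists_eq_or_imp]
    rfl

theorem matches'_of_symbols? {p : Pattern} {l : List (Fin 8)} (h : symbols? p = some l) :
    p.matches' = (oneOf l).matches' := by
  induction p generalizing l with
  | zero => simp [symbols?] at h; subst h; rfl
  | epsilon => simp [symbols?] at h
  | char t => simp [symbols?] at h; subst h; simp [oneOf]
  | plus p q ihp ihq =>
    simp only [symbols?, Option.bind_eq_bind, Option.bind_eq_some_iff, Option.pure_def,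
      Option.some.injEq] at h
    obtain ⟨l₁, h₁, l₂, h₂, rfl⟩ := h
    change p.matches' + q.matches' = _
    rw [ihp h₁, ihq h₂]
    ext w
    simp only [Language.mem_add, mem_matches'_oneOf, List.mem_append]
    grind
  | comp p q => simp [symbols?] at h
  | star p => simp [symbols?] at h

theorem factorLang_append (l l' : List Factor) :
    factorLang (l ++ l') = factorLang l * factorLang l' := by
  induction l with
  | nil => simp [factorLang]
  | cons a l ih => simp [factorLang, ih, mul_assoc]

theorem matches'_of_factors? {p : Pattern} {l : List Factor} (h : factors? p = some l) :
    p.matches' = factorLang l := by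
  induction p generalizing l with
  | comp p q ihp ihq =>
    simp only [factors?, Option.bind_eq_bind, Option.bind_eq_some_iff, Option.pure_def,
      Option.some.injEq] at h
    obtain ⟨l₁, h₁, l₂, h₂, rfl⟩ := h
    rw [factorLang_append, ← ihp h₁, ← ihq h₂]
    rfl
  | star p =>
    simp only [factors?, Option.bind_eq_bind, Option.bind_eq_some_iff, Option.pure_def,
      Option.some.injEq] at h
    obtain ⟨l₁, h₁, rfl⟩ := h
    simp only [factorLang, if_true, mul_one, ← matches'_of_symbols? h₁]
    rfl
  | zero | epsilon | char | plus =>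
    simp only [factors?, Option.bind_eq_bind, Option.bind_eq_some_iff, Option.pure_def,
      Option.some.injEq] at h
    obtain ⟨l₁, h₁, rfl⟩ := h
    rw [matches'_of_symbols? h₁, factorLang, factorLang, mul_one, if_neg Bool.false_ne_true]

theorem nil_mem_factorLang_cons (a : Factor) (l : List Factor) :
    [] ∈ factorLang (a :: l) ↔ a.starred = true ∧ [] ∈ factorLang l := by
  rw [factorLang, Language.mem_mul]
  cases h : a.starred
  · simp [mem_matches'_oneOf]
  · simp [Language.nil_mem_kstar]

theorem cons_mem_factorLang_cons (a : Factor) (l : List Factor) (c : Fin 8) (w : List (Fin 8)) :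
    c :: w ∈ factorLang (a :: l) ↔
      (c ∈ a.syms ∧ w ∈ factorLang (if a.starred then a :: l else l)) ∨
        (a.starred = true ∧ c :: w ∈ factorLang l) := by
  cases h : a.starred
  · rw [factorLang, h, if_neg Bool.false_ne_true, Language.mem_mul]
    simp only [mem_matches'_oneOf]
    constructor
    · rintro ⟨_, ⟨t, ht, rfl⟩, v, hv, e⟩
      simp at e
      obtain ⟨rfl, rfl⟩ := e
      simp [ht, hv]
    · rintro (⟨h1, h2⟩ | h)
      · exact ⟨[c], ⟨c, h1, rfl⟩, w, by simpa using h2, rfl⟩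
      · simp at h
  · have key : factorLang (a :: l) =
        (oneOf a.syms).matches' * factorLang (a :: l) + factorLang l := by
      simp only [factorLang, h, if_true]
      conv_lhs => rw [← Language.one_add_self_mul_kstar_eq_kstar]
      rw [add_mul, one_mul, mul_assoc, add_comm]
    conv_lhs => rw [key]
    rw [Language.mem_add, Language.mem_mul]
    simp only [mem_matches'_oneOf, true_and, if_true]
    refine or_congr_left ⟨?_, fun h => ⟨[c], ⟨c, h.1, rfl⟩, w, h.2, rfl⟩⟩
    rintro ⟨_, ⟨t, ht, rfl⟩, v, hv, e⟩
    simp at e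
    obtain ⟨rfl, rfl⟩ := e
    exact ⟨ht, hv⟩

/-- The union of the languages of the suffixes of a sequence of factors, the suffix obtained by
deleting the first `i` factors being included if the bit `i` of `S` is set. -/
def SuffixMatch : List Factor → ℕ → List (Fin 8) → Prop
  | [], S, w => S % 2 = 1 ∧ w ∈ factorLang []
  | a :: l, S, w => (S % 2 = 1 ∧ w ∈ factorLang (a :: l)) ∨ SuffixMatch l (S / 2) w

/-- The set of suffixes, encoded as in `SuffixMatch`, that remain after the symbol `c` is read.  A
leading starred factor either reads `c` and stays or is skipped, which puts the next suffix into
the set: `2 * (n / 2) + 1` is `n` with its bit `0` set. -/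
def readSymbol : List Factor → ℕ → Fin 8 → ℕ
  | [], _, _ => 0
  | a :: l, S, c =>
    bif S % 2 == 1 then
      bif a.starred then
        2 * readSymbol l (2 * (S / 2 / 2) + 1) c + (a.syms.contains c).toNat
      else bif a.syms.contains c then 2 * (2 * (readSymbol l (S / 2) c / 2) + 1)
      else 2 * readSymbol l (S / 2) c
    else 2 * readSymbol l (S / 2) c

/-- Whether some suffix in a set, encoded as in `SuffixMatch`, matches the empty word. -/
def acceptsNil : List Factor → ℕ → Bool
  | [], S => S % 2 == 1
  | a :: l, S => ((S % 2 == 1) && a.starred && l.all (·.starred)) || acceptsNil l (S / 2)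

theorem nil_mem_factorLang (l : List Factor) :
    [] ∈ factorLang l ↔ l.all (·.starred) = true := by
  induction l with
  | nil => simp [factorLang]
  | cons a l ih => rw [nil_mem_factorLang_cons, ih, List.all_cons, Bool.and_eq_true]

theorem suffixMatch_nil (l : List Factor) (S : ℕ) :
    SuffixMatch l S [] ↔ acceptsNil l S = true := by
  induction l generalizing S with
  | nil => simp [SuffixMatch, acceptsNil, factorLang]
  | cons a l ih =>
    simp only [SuffixMatch, acceptsNil, ih, nil_mem_factorLang,
      Bool.or_eq_true, Bool.and_eq_true, beq_iff_eq, and_assoc, List.all_cons]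

theorem suffixMatch_insert_zero (l : List Factor) (S : ℕ) (w : List (Fin 8)) :
    SuffixMatch l (2 * (S / 2) + 1) w ↔ w ∈ factorLang l ∨ SuffixMatch l S w := by
  have h1 : (2 * (S / 2) + 1) % 2 = 1 := by omega
  have h2 : (2 * (S / 2) + 1) / 2 = S / 2 := by omega
  cases l with
  | nil => simp only [SuffixMatch, h1]; tauto
  | cons a l => simp only [SuffixMatch, h1, h2]; tauto

theorem suffixMatch_readSymbol (l : List Factor) (S : ℕ) (c : Fin 8) (w : List (Fin 8)) :
    SuffixMatch l (readSymbol l S c) w ↔ SuffixMatch l S (c :: w) := by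
  induction l generalizing S with
  | nil => simp [SuffixMatch, readSymbol, factorLang, Language.mem_one]
  | cons a l ih =>
    have e0 (k : ℕ) : 2 * k % 2 ≠ 1 := by omega
    have e1 (k : ℕ) : 2 * k / 2 = k := by omega
    have e2 (k : ℕ) : (2 * k + 1) % 2 = 1 := by omega
    have e3 (k : ℕ) : (2 * k + 1) / 2 = k := by omega
    simp only [SuffixMatch, readSymbol, cons_mem_factorLang_cons]
    rcases Nat.mod_two_eq_zero_or_one S with hS | hS
    · simp [hS, ih, e1]
    · cases ha : a.starred <;> cases hc : a.syms.contains c <;>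
        simp only [hS, beq_self_eq_true, cond_true, cond_false, e0, e1, e2, e3, ih,
          suffixMatch_insert_zero, Bool.toNat_true, Bool.toNat_false, Nat.add_zero] <;>
        simp only [List.contains_eq_mem, decide_eq_true_eq, decide_eq_false_iff_not] at hc <;>
        simp [hc, or_assoc]

/-- A sequence of factors is matched by running the subset automaton from the set that contains
the whole sequence only. -/
theorem mem_factorLang_iff (l : List Factor) (w : List (Fin 8)) :
    w ∈ factorLang l ↔ acceptsNil l (w.foldl (readSymbol l) 1) = true := by
  have h (S : ℕ) : SuffixMatch l S w ↔ acceptsNil l (w.foldl (readSymbol l) S) = true := by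
    induction w generalizing S with
    | nil => exact suffixMatch_nil l S
    | cons c w ih => rw [List.foldl_cons, ← ih, suffixMatch_readSymbol]
  have h0 (l : List Factor) : ¬ SuffixMatch l 0 w := by
    induction l with
    | nil => simp [SuffixMatch]
    | cons a l ih => simpa [SuffixMatch] using ih
  rw [← h]
  have := suffixMatch_insert_zero l 0 w
  simpa [h0 l] using this.symm

/-! ### Carries -/

/-- The majority of three bits: the carry produced by adding them. -/
def maj (a b c : Bool) : Bool := (a && b) || (a && c) || (b && c)

/-- The carry into position `i` of the sum of the numbers with bits `f` and `g`, position `0` being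
the least significant one, if `c` is carried into position `0`. -/
def carry (f g : ℕ → Bool) (c : Bool) : ℕ → Bool
  | 0 => c
  | i + 1 => maj (f i) (g i) (carry f g c i)

theorem carry_congr {f f' g g' : ℕ → Bool} (c : Bool) {n : ℕ} (hf : ∀ i < n, f i = f' i)
    (hg : ∀ i < n, g i = g' i) : carry f g c n = carry f' g' c n := by
  induction n with
  | zero => rfl
  | succ n ih =>
    rw [carry, carry, hf n n.lt_succ_self, hg n n.lt_succ_self,
      ih (fun i hi => hf i (hi.trans n.lt_succ_self)) fun i hi => hg i (hi.trans n.lt_succ_self)]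

theorem carry_add (f g : ℕ → Bool) (c : Bool) (m i : ℕ) :
    carry f g c (m + i) =
      carry (fun j => f (m + j)) (fun j => g (m + j)) (carry f g c m) i := by
  induction i with
  | zero => rfl
  | succ i ih => rw [← add_assoc, carry, carry, ih]

theorem getLsbD_add_eq_carry {n : ℕ} (x y : BitVec n) {i : ℕ} (hi : i < n) :
    (x + y).getLsbD i =
      (x.getLsbD i ^^ y.getLsbD i ^^ carry x.getLsbD y.getLsbD false i) := by
  have h (i : ℕ) : BitVec.carry i x y false = carry x.getLsbD y.getLsbD false i := by
    induction i with
    | zero => simp [carry]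
    | succ i ih => rw [BitVec.carry_succ, ih, carry]; simp [Bool.atLeastTwo, maj]
  rw [BitVec.getLsbD_add hi, h, Bool.xor_assoc]

/-- A bit of an octal symbol: `bit 2`, `bit 1`, `bit 0` of `octal a b c` are `a`, `b`, `c`. -/
def bit (k : ℕ) (q : Fin 8) : Bool := q.val.testBit k

@[simp] theorem bit_octal (a b c : Bool) :
    bit 2 (octal a b c) = a ∧ bit 1 (octal a b c) = b ∧ bit 0 (octal a b c) = c := by
  revert a b c; decide

theorem octal_bit (q : Fin 8) : octal (bit 2 q) (bit 1 q) (bit 0 q) = q := by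
  revert q; decide

/-- The transitions of the carry automaton.  A state packs the carries of the three sums
`x + α`, `y + β` and `(x ⊕ y) + γ` into an octal symbol; the bits of `q` are the bits of
`α`, `β`, `γ` at the current position.  For each choice of the bits of `x` and `y`, the state `s`
passes to the state of the carries produced, provided that the bits of `(x + α) ⊕ (y + β)` and
`(x ⊕ y) + γ` agree, which does not depend on that choice. -/
def targets (q s : Fin 8) : List (Fin 8) :=
  bif bit 2 q ^^ bit 1 q ^^ bit 0 q ^^ bit 2 s ^^ bit 1 s ^^ bit 0 s then [] else
    [(false, false), (false, true), (true, false), (true, true)].map fun p =>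
      octal (maj p.1 (bit 2 q) (bit 2 s)) (maj p.2 (bit 1 q) (bit 1 s))
        (maj (p.1 ^^ p.2) (bit 0 q) (bit 0 s))

theorem mem_targets {q s t : Fin 8} : t ∈ targets q s ↔
    (bit 2 q ^^ bit 1 q ^^ bit 0 q ^^ bit 2 s ^^ bit 1 s ^^ bit 0 s) = false ∧
      ∃ a b : Bool, t = octal (maj a (bit 2 q) (bit 2 s)) (maj b (bit 1 q) (bit 1 s))
        (maj (a ^^ b) (bit 0 q) (bit 0 s)) := by
  rw [targets]
  cases bit 2 q ^^ bit 1 q ^^ bit 0 q ^^ bit 2 s ^^ bit 1 s ^^ bit 0 s <;>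
    simp [Bool.exists_bool, or_assoc]

/-- The carry automaton can pass from the state `s` to the state `t` while it reads the word from
its last, least significant symbol to its first. -/
def Reach : List (Fin 8) → Fin 8 → Fin 8 → Prop
  | [], s, t => s = t
  | q :: w, s, t => ∃ u, Reach w s u ∧ t ∈ targets q u

/-- The octal word of the `n` least significant bits of three bit sequences. -/
def bitWord (α β γ : ℕ → Bool) : ℕ → List (Fin 8)
  | 0 => []
  | n + 1 => octal (α n) (β n) (γ n) :: bitWord α β γ n

theorem octalWord_eq_bitWord {n : ℕ} (α β γ : BitVec n) :
    octalWord α β γ = bitWord α.getLsbD β.getLsbD γ.getLsbD n := by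
  have h (f g k : ℕ → Bool) (n : ℕ) : bitWord f g k n =
      List.ofFn fun i : Fin n => octal (f (n - 1 - i)) (g (n - 1 - i)) (k (n - 1 - i)) := by
    induction n with
    | zero => rfl
    | succ n ih =>
      rw [bitWord, ih, List.ofFn_succ]
      simp [Nat.sub_sub, Nat.add_comm]
  rw [h, octalWord]
  rfl

theorem reach_bitWord (α β γ : ℕ → Bool) (s t : Fin 8) (n : ℕ) :
    Reach (bitWord α β γ n) s t ↔ ∃ x y : ℕ → Bool,
      (∀ i < n, (α i ^^ β i ^^ γ i ^^ carry x α (bit 2 s) i ^^ carry y β (bit 1 s) i ^^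
        carry (fun j => x j ^^ y j) γ (bit 0 s) i) = false) ∧
      t = octal (carry x α (bit 2 s) n) (carry y β (bit 1 s) n)
        (carry (fun j => x j ^^ y j) γ (bit 0 s) n) := by
  induction n generalizing t with
  | zero =>
    simp only [bitWord, Reach, carry, octal_bit]
    exact ⟨fun h => ⟨fun _ => false, fun _ => false, by simp, h.symm⟩, fun ⟨_, _, _, h⟩ => h.symm⟩
  | succ n ih =>
    simp only [bitWord, Reach, ih]
    constructor
    · rintro ⟨_, ⟨x, y, hxy, rfl⟩, h⟩
      simp only [mem_targets, bit_octal] at h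
      obtain ⟨h0, a, b, rfl⟩ := h
      have hx : ∀ i < n, x i = Function.update x n a i := fun i hi => by
        rw [Function.update_of_ne hi.ne]
      have hy : ∀ i < n, y i = Function.update y n b i := fun i hi => by
        rw [Function.update_of_ne hi.ne]
      have e1 : ∀ i ≤ n, carry x α (bit 2 s) i = carry (Function.update x n a) α (bit 2 s) i :=
        fun i hi => carry_congr _ (fun j hj => hx j (hj.trans_le hi)) fun _ _ => rfl
      have e2 : ∀ i ≤ n, carry y β (bit 1 s) i = carry (Function.update y n b) β (bit 1 s) i :=
        fun i hi => carry_congr _ (fun j hj => hy j (hj.trans_le hi)) fun _ _ => rfl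
      have e3 : ∀ i ≤ n, carry (fun j => x j ^^ y j) γ (bit 0 s) i =
          carry (fun j => Function.update x n a j ^^ Function.update y n b j) γ (bit 0 s) i :=
        fun i hi => carry_congr _ (fun j hj => by
          rw [hx j (hj.trans_le hi), hy j (hj.trans_le hi)]) fun _ _ => rfl
      refine ⟨Function.update x n a, Function.update y n b, fun i hi => ?_, ?_⟩
      · rw [← e1 i (by omega), ← e2 i (by omega), ← e3 i (by omega)]
        rcases Nat.lt_succ_iff_lt_or_eq.1 hi with hi | rfl
        · exact hxy i hi
        · exact h0
      · rw [e1 n le_rfl, e2 n le_rfl, e3 n le_rfl]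
        simp [carry]
    · rintro ⟨x, y, hxy, rfl⟩
      refine ⟨_, ⟨x, y, fun i hi => hxy i (by omega), rfl⟩, ?_⟩
      simp only [mem_targets, bit_octal]
      exact ⟨hxy n (by omega), x n, y n, rfl⟩

/-! ### Rotation splits the differential equation into two runs -/

/-- The bits at the positions `< m` are `f`, those from the position `m` on are `f'`. -/
def appendBits (m : ℕ) (f f' : ℕ → Bool) (i : ℕ) : Bool := if i < m then f i else f' (i - m)

theorem carry_appendBits_low (m : ℕ) {f f' g g' : ℕ → Bool} (c : Bool) {i : ℕ} (hi : i ≤ m) :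
    carry (appendBits m f f') (appendBits m g g') c i = carry f g c i :=
  carry_congr c (fun _ hj => if_pos (hj.trans_le hi)) fun _ hj => if_pos (hj.trans_le hi)

theorem carry_appendBits_high (m : ℕ) {f f' g g' : ℕ → Bool} (c : Bool) (i : ℕ) :
    carry (appendBits m f f') (appendBits m g g') c (m + i) = carry f' g' (carry f g c m) i := by
  rw [carry_add, carry_appendBits_low m c le_rfl]
  simp [appendBits]

theorem getLsbD_append_eq {m r : ℕ} (x' : BitVec r) (x : BitVec m) :
    (x' ++ x).getLsbD = appendBits m x.getLsbD x'.getLsbD := by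
  ext i
  rw [BitVec.getLsbD_append, appendBits]

theorem getLsbD_append_add_append_low {m r : ℕ} (x' a' : BitVec r) (x a : BitVec m) {i : ℕ}
    (hi : i < m) : ((x' ++ x) + (a' ++ a)).getLsbD i =
      (x.getLsbD i ^^ a.getLsbD i ^^ carry x.getLsbD a.getLsbD false i) := by
  rw [getLsbD_add_eq_carry _ _ (by omega), getLsbD_append_eq, getLsbD_append_eq,
    carry_appendBits_low m _ hi.le]
  simp [appendBits, hi]

theorem getLsbD_append_add_append_high {m r : ℕ} (x' a' : BitVec r) (x a : BitVec m) {i : ℕ}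
    (hi : i < r) : ((x' ++ x) + (a' ++ a)).getLsbD (m + i) =
      (x'.getLsbD i ^^ a'.getLsbD i ^^
        carry x'.getLsbD a'.getLsbD (carry x.getLsbD a.getLsbD false m) i) := by
  rw [getLsbD_add_eq_carry _ _ (by omega), getLsbD_append_eq, getLsbD_append_eq,
    carry_appendBits_high m]
  simp [appendBits]

theorem rotateLeft_append {m r : ℕ} (u : BitVec r) (v : BitVec m) :
    (u ++ v).rotateLeft r = (v ++ u).cast (Nat.add_comm m r) := by
  apply BitVec.eq_of_getLsbD_eq
  intro i hi
  rw [BitVec.getLsbD_cast, BitVec.getLsbD_append, BitVec.getLsbD_rotateLeft]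
  rcases Nat.eq_zero_or_pos m with rfl | hm
  · rw [Nat.add_zero] at hi
    simp [hi]
  · rw [Nat.mod_eq_of_lt (by omega : r < r + m)]
    by_cases h : i < r
    · simp only [h, decide_true, cond_true, if_true, BitVec.getLsbD_append]
      rw [if_neg (by omega)]
      congr 1
      omega
    · simp only [h, decide_false, cond_false, if_false, BitVec.getLsbD_append, hi, decide_true,
        Bool.true_and]
      rw [if_pos (by omega)]

theorem exists_eq_append {m r : ℕ} (z : BitVec (r + m)) :
    ∃ (u : BitVec r) (v : BitVec m), z = u ++ v := by
  refine ⟨BitVec.ofFnLE fun i => z.getLsbD (m + i), BitVec.ofFnLE fun i => z.getLsbD i, ?_⟩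
  apply BitVec.eq_of_getLsbD_eq
  intro i hi
  rw [BitVec.getLsbD_append]
  split_ifs with h
  · rw [BitVec.getLsbD_ofFnLE, dif_pos h]
  · rw [BitVec.getLsbD_ofFnLE, dif_pos (by omega)]
    congr 1
    simp only
    omega

theorem append_eq_iff {m r : ℕ} (u : BitVec r) (v : BitVec m) (z : BitVec (m + r)) :
    v ++ u = z ↔ (∀ i < m, v.getLsbD i = z.getLsbD (r + i)) ∧
      ∀ i < r, u.getLsbD i = z.getLsbD i := by
  constructor
  · rintro rfl
    refine ⟨fun i _ => ?_, fun i hi => ?_⟩ <;> rw [BitVec.getLsbD_append]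
    · rw [if_neg (by omega), Nat.add_sub_cancel_left]
    · rw [if_pos hi]
  · rintro ⟨hv, hu⟩
    apply BitVec.eq_of_getLsbD_eq
    intro i hi
    rw [BitVec.getLsbD_append]
    split_ifs with h
    · exact hu i h
    · rw [hv _ (by omega), Nat.add_sub_cancel' (by omega)]

/-- In `(x' ‖ x) + (α' ‖ α)` the carry out of `x + α` enters `x' + α'`, and in
`((x ⊕ y) ‖ (x' ⊕ y')) + (γ ‖ γ')` the carry out of `(x' ⊕ y') + γ'` enters `(x ⊕ y) + γ`. -/
theorem differential_iff {m r : ℕ} (α β γ x y : BitVec m) (α' β' γ' x' y' : BitVec r) :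
    (((x' ++ x) + (α' ++ α)) ^^^ ((y' ++ y) + (β' ++ β))).rotateLeft r =
        ((x' ++ x) ^^^ (y' ++ y)).rotateLeft r + (γ ++ γ').cast (Nat.add_comm m r) ↔
      (∀ i < m, (α.getLsbD i ^^ β.getLsbD i ^^ γ.getLsbD i ^^
        carry x.getLsbD α.getLsbD false i ^^ carry y.getLsbD β.getLsbD false i ^^
        carry (fun j => x.getLsbD j ^^ y.getLsbD j) γ.getLsbD
          (carry (fun j => x'.getLsbD j ^^ y'.getLsbD j) γ'.getLsbD false r) i) = false) ∧
      ∀ i < r, (α'.getLsbD i ^^ β'.getLsbD i ^^ γ'.getLsbD i ^^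
        carry x'.getLsbD α'.getLsbD (carry x.getLsbD α.getLsbD false m) i ^^
        carry y'.getLsbD β'.getLsbD (carry y.getLsbD β.getLsbD false m) i ^^
        carry (fun j => x'.getLsbD j ^^ y'.getLsbD j) γ'.getLsbD false i) = false := by
  obtain ⟨u, v, huv⟩ := exists_eq_append ((x' ++ x) + (α' ++ α) ^^^ ((y' ++ y) + (β' ++ β)))
  have hxor : (x' ++ x) ^^^ (y' ++ y) = (x' ^^^ y') ++ (x ^^^ y) := by
    apply BitVec.eq_of_getLsbD_eq
    intro i hi
    simp only [BitVec.getLsbD_xor, BitVec.getLsbD_append]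
    split_ifs <;> rfl
  have hv (i : ℕ) (hi : i < m) :
      ((x.getLsbD i ^^ α.getLsbD i ^^ carry x.getLsbD α.getLsbD false i) ^^
        (y.getLsbD i ^^ β.getLsbD i ^^ carry y.getLsbD β.getLsbD false i)) = v.getLsbD i := by
    simpa only [BitVec.getLsbD_xor, BitVec.getLsbD_append, hi, if_true,
      getLsbD_append_add_append_low _ _ _ _ hi] using congrArg (fun z => z.getLsbD i) huv
  have hu (i : ℕ) (hi : i < r) : ((x'.getLsbD i ^^ α'.getLsbD i ^^
        carry x'.getLsbD α'.getLsbD (carry x.getLsbD α.getLsbD false m) i) ^^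
      (y'.getLsbD i ^^ β'.getLsbD i ^^
        carry y'.getLsbD β'.getLsbD (carry y.getLsbD β.getLsbD false m) i)) = u.getLsbD i := by
    simpa only [BitVec.getLsbD_xor, BitVec.getLsbD_append, Nat.not_lt.2 (Nat.le_add_right m i),
      if_false, Nat.add_sub_cancel_left, getLsbD_append_add_append_high _ _ _ _ hi] using
      congrArg (fun z => z.getLsbD (m + i)) huv
  rw [huv, hxor, rotateLeft_append, rotateLeft_append]
  have hcast : (((x ^^^ y) ++ (x' ^^^ y')).cast (Nat.add_comm m r) +
      (γ ++ γ').cast (Nat.add_comm m r)) =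
        (((x ^^^ y) ++ (x' ^^^ y')) + (γ ++ γ')).cast (Nat.add_comm m r) := by
    apply BitVec.eq_of_toNat_eq
    simp [BitVec.toNat_add, Nat.add_comm m r]
  have e1 : (x ^^^ y).getLsbD = fun j => x.getLsbD j ^^ y.getLsbD j := by
    ext j; exact BitVec.getLsbD_xor
  have e2 : (x' ^^^ y').getLsbD = fun j => x'.getLsbD j ^^ y'.getLsbD j := by
    ext j; exact BitVec.getLsbD_xor
  have hbits (a b c d e f p q : Bool) :
      (((p ^^ a ^^ d) ^^ (q ^^ b ^^ e)) = ((p ^^ q) ^^ c ^^ f)) ↔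
        (a ^^ b ^^ c ^^ d ^^ e ^^ f) = false := by
    revert a b c d e f p q; decide
  have hinj (y z : BitVec (m + r)) :
      y.cast (Nat.add_comm m r) = z.cast (Nat.add_comm m r) ↔ y = z :=
    ⟨fun h => by simpa using congrArg (BitVec.cast (Nat.add_comm r m)) h, congrArg _⟩
  rw [hcast, hinj, append_eq_iff]
  refine and_congr (forall₂_congr fun i hi => ?_) (forall₂_congr fun i hi => ?_)
  · rw [getLsbD_append_add_append_high _ _ _ _ hi, ← hv i hi, e1, e2, hbits]
  · rw [getLsbD_append_add_append_low _ _ _ _ hi, ← hu i hi, e2, hbits]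

/-- The differential equation is solvable if and only if two runs of the carry automaton exist
that exchange carries: the final carries of `x + α` and `y + β` in the run over the word of
`(α, β, γ)` are the initial ones in the run over the word of `(α', β', γ')`, and the final carry of
`(x' ⊕ y') + γ'` in the latter is the initial carry of `(x ⊕ y) + γ` in the former. -/
theorem exists_differential_iff {m r : ℕ} (α β γ : BitVec m) (α' β' γ' : BitVec r) :
    (∃ x y : BitVec (r + m), ((x + (α' ++ α)) ^^^ (y + (β' ++ β))).rotateLeft r =
        (x ^^^ y).rotateLeft r + (γ ++ γ').cast (Nat.add_comm m r)) ↔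
      ∃ s t : Fin 8, Reach (octalWord α β γ) (octal false false (bit 0 t)) s ∧
        Reach (octalWord α' β' γ') (octal (bit 2 s) (bit 1 s) false) t := by
  simp only [octalWord_eq_bitWord, reach_bitWord, bit_octal]
  constructor
  · rintro ⟨X, Y, h⟩
    obtain ⟨x', x, rfl⟩ := exists_eq_append X
    obtain ⟨y', y, rfl⟩ := exists_eq_append Y
    rw [differential_iff] at h
    refine ⟨_, octal (carry x'.getLsbD α'.getLsbD (carry x.getLsbD α.getLsbD false m) r)
      (carry y'.getLsbD β'.getLsbD (carry y.getLsbD β.getLsbD false m) r)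
      (carry (fun j => x'.getLsbD j ^^ y'.getLsbD j) γ'.getLsbD false r),
      ⟨x.getLsbD, y.getLsbD, ?_, rfl⟩, x'.getLsbD, y'.getLsbD, ?_, ?_⟩
    · simpa only [bit_octal] using h.1
    · simpa only [bit_octal] using h.2
    · simp only [bit_octal]
  · rintro ⟨_, t, ⟨x, y, h, rfl⟩, x', y', h', ht⟩
    simp only [bit_octal] at h' ht
    have ht0 := congrArg (bit 0) ht
    rw [(bit_octal _ _ _).2.2] at ht0
    rw [ht0] at h
    have hofFn (n : ℕ) (f : ℕ → Bool) (i : ℕ) (hi : i < n) :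
        (BitVec.ofFnLE fun j : Fin n => f j).getLsbD i = f i := by
      rw [BitVec.getLsbD_ofFnLE, dif_pos hi]
    have hc (n : ℕ) (f g : ℕ → Bool) (c : Bool) (i : ℕ) (hi : i ≤ n) :
        carry (BitVec.ofFnLE fun j : Fin n => f j).getLsbD g c i = carry f g c i :=
      carry_congr c (fun j hj => hofFn n f j (hj.trans_le hi)) fun _ _ => rfl
    have hc₂ (n : ℕ) (f f' g : ℕ → Bool) (c : Bool) (i : ℕ) (hi : i ≤ n) :
        carry (fun k => (BitVec.ofFnLE fun j : Fin n => f j).getLsbD k ^^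
          (BitVec.ofFnLE fun j : Fin n => f' j).getLsbD k) g c i =
            carry (fun k => f k ^^ f' k) g c i :=
      carry_congr c (fun j hj => by
        rw [hofFn n f j (hj.trans_le hi), hofFn n f' j (hj.trans_le hi)]) fun _ _ => rfl
    refine ⟨(BitVec.ofFnLE fun j : Fin r => x' j) ++ (BitVec.ofFnLE fun j : Fin m => x j),
      (BitVec.ofFnLE fun j : Fin r => y' j) ++ (BitVec.ofFnLE fun j : Fin m => y j), ?_⟩
    rw [differential_iff, hc m x _ _ m le_rfl, hc m y _ _ m le_rfl, hc₂ r x' y' _ _ r le_rfl]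
    refine ⟨fun i hi => ?_, fun i hi => ?_⟩
    · rw [hc m x _ _ i hi.le, hc m y _ _ i hi.le, hc₂ m x y _ _ i hi.le]
      exact h i hi
    · rw [hc r x' _ _ i hi.le, hc r y' _ _ i hi.le, hc₂ r x' y' _ _ i hi.le]
      exact h' i hi

theorem adpXR_eq_zero_iff {m r : ℕ} (α β γ : BitVec m) (α' β' γ' : BitVec r) :
    adpXR r (α' ++ α) (β' ++ β) ((γ ++ γ').cast (Nat.add_comm m r)) = 0 ↔
      ∀ s t : Fin 8, Reach (octalWord α β γ) (octal false false (bit 0 t)) s →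
        ¬ Reach (octalWord α' β' γ') (octal (bit 2 s) (bit 1 s) false) t := by
  have h : adpXR r (α' ++ α) (β' ++ β) ((γ ++ γ').cast (Nat.add_comm m r)) = 0 ↔
      ¬ ∃ x y : BitVec (r + m), ((x + (α' ++ α)) ^^^ (y + (β' ++ β))).rotateLeft r =
        (x ^^^ y).rotateLeft r + (γ ++ γ').cast (Nat.add_comm m r) := by
    rw [adpXR, adp, div_eq_zero_iff, or_iff_left (by positivity), Nat.cast_eq_zero,
      Finset.card_eq_zero, Finset.filter_eq_empty_iff]
    constructor
    · rintro h ⟨x, y, hxy⟩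
      exact h (Finset.mem_univ ![x, y]) hxy
    · intro h x _ hx
      exact h ⟨x 0, x 1, hx⟩
  rw [h, exists_differential_iff]
  push Not
  rfl

/-! ### Comparing runs of the carry automaton with patterns -/

/-- The octal alphabet. -/
def alphabet : List (Fin 8) := [0, 1, 2, 3, 4, 5, 6, 7]

theorem mem_alphabet (q : Fin 8) : q ∈ alphabet := by
  revert q; decide

/-- The states from which a state in `S` is reached by reading `q`.  A set of states is encoded as
the natural number whose bits are its characteristic function. -/
def pre (S : ℕ) (q : Fin 8) : ℕ :=
  Nat.ofBits fun s : Fin 8 => (targets q s).any fun t => S.testBit t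

/-- The encoding of the set of states that satisfy `V`. -/
def encode (V : Fin 8 → Bool) : ℕ := Nat.ofBits V

/-- Runs start at the last symbol of the word, so folding from its first symbol on computes
preimages. -/
theorem testBit_foldl_pre (w : List (Fin 8)) (S : ℕ) (s : Fin 8) :
    (w.foldl pre S).testBit s = true ↔ ∃ t, Reach w s t ∧ S.testBit t = true := by
  induction w generalizing S with
  | nil => simp [Reach]
  | cons q w ih =>
    rw [List.foldl_cons, ih]
    have h (u : Fin 8) :
        (pre S q).testBit u = true ↔ ∃ t, t ∈ targets q u ∧ S.testBit t = true := by
      simp [pre, Nat.testBit_ofBits_lt _ _ u.isLt, List.any_eq_true]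
    simp only [h, Reach]
    grind

/-- One step of the product of the subset automaton of the carry automaton, whose state is the
head of the list, with the subset automata of several patterns. -/
def productStep (ls : List (List Factor)) : List ℕ → Fin 8 → List ℕ
  | [], _ => []
  | S :: Ss, q => pre S q :: List.zipWith (fun l S => readSymbol l S q) ls Ss

theorem foldl_productStep (ls : List (List Factor)) (S : ℕ) (f : List Factor → ℕ)
    (w : List (Fin 8)) : w.foldl (productStep ls) (S :: ls.map f) =
      w.foldl pre S :: ls.map fun l => w.foldl (readSymbol l) (f l) := by
  induction w generalizing S f with
  | nil => rfl
  | cons q w ih =>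
    simp only [List.foldl_cons, ← ih]
    simp [productStep, List.zipWith_map_right, List.zipWith_self]

/-- Checks that the following pair has the property `good` for every nonempty word: the set of the
states from which the word leads to a state in `V`, and the list of the truth values of the matches
of the word with the patterns.  The number of steps allowed, `1000`, is more than any of the
searches below needs. -/
def verifyPatterns (V : Fin 8 → Bool) (ps : List Pattern) (good : ℕ → List Bool → Bool) : Bool :=
  match ps.mapM factors? with
  | none => false
  | some ls =>
    verify (productStep ls) alphabet
      (fun s => good (s.headD 0) (List.zipWith acceptsNil ls s.tail)) 1000
      (alphabet.map (productStep ls (encode V :: ls.map fun _ => 1))) []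

open Classical in
theorem good_of_verifyPatterns {V : Fin 8 → Bool} {ps : List Pattern}
    {good : ℕ → List Bool → Bool} (h : verifyPatterns V ps good = true)
    {w : List (Fin 8)} (hw : w ≠ []) :
    good (w.foldl pre (encode V)) (ps.map fun p => decide (Satisfies w p)) = true := by
  rw [verifyPatterns] at h
  split at h
  · simp at h
  · rename_i ls hls
    have := good_foldl_of_verify mem_alphabet h hw
    rw [foldl_productStep, List.headD_cons, List.tail_cons] at this
    convert this using 2
    rw [List.zipWith_map_right, List.zipWith_self]
    clear h this
    induction ps generalizing ls with
    | nil =>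
      simp only [List.mapM_nil, Option.pure_def, Option.some.injEq] at hls
      simp [← hls]
    | cons p ps ih =>
      simp only [List.mapM_cons, Option.bind_eq_bind, Option.bind_eq_some_iff, Option.pure_def,
        Option.some.injEq] at hls
      obtain ⟨l, hl, ls, hls, rfl⟩ := hls
      rw [List.map_cons, List.map_cons, ih ls hls]
      congr 1
      rw [Bool.eq_iff_iff, decide_eq_true_iff, Satisfies, matches'_of_factors? hl,
        mem_factorLang_iff]

theorem testBit_foldl_encode (w : List (Fin 8)) (V : Fin 8 → Bool) (s : Fin 8) :
    (w.foldl pre (encode V)).testBit s = true ↔ ∃ t, Reach w s t ∧ V t = true := by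
  simp only [testBit_foldl_pre, encode, Nat.testBit_ofBits_lt _ _ (Fin.isLt _), Fin.eta]

/-! ### The columns of the table -/

/-- The run over `w` can start with the carry `c` into the third sum and none into the others, and
end with the carries `a`, `b` out of the first two sums. -/
def CarryOut (w : List (Fin 8)) (a b c : Bool) : Prop :=
  ∃ t, Reach w (octal false false c) t ∧ bit 2 t = a ∧ bit 1 t = b

/-- The run over `w` can start with the carries `a`, `b` into the first two sums and none into the
third, and end with the carry `c` out of the third sum. -/
def CarryIn (w : List (Fin 8)) (a b c : Bool) : Prop :=
  ∃ t, Reach w (octal a b false) t ∧ bit 0 t = c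

theorem adpXR_eq_zero_iff_carries {m r : ℕ} (α β γ : BitVec m) (α' β' γ' : BitVec r) :
    adpXR r (α' ++ α) (β' ++ β) ((γ ++ γ').cast (Nat.add_comm m r)) = 0 ↔
      ∀ a b c, CarryOut (octalWord α β γ) a b c → ¬ CarryIn (octalWord α' β' γ') a b c := by
  rw [adpXR_eq_zero_iff]
  constructor
  · rintro h _ _ _ ⟨s, hs, rfl, rfl⟩ ⟨t, ht, rfl⟩
    exact h s t hs ht
  · intro h s t hs ht
    exact h _ _ _ ⟨s, hs, rfl, rfl⟩ ⟨t, ht, rfl⟩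

/-- The elements of the column `k` of the table, the columns being counted from `0`. -/
def elements (k : Fin 7) : List Pattern := (zeroTable.get (k.cast rfl)).2

/-- The word satisfies some element of the column `k`. -/
def InColumn (k : Fin 7) (w : List (Fin 8)) : Prop := ∃ Y ∈ elements k, Satisfies w Y

/-- The pairs of carries to which the mark of the column `k ≤ 4` restricts the more significant
word: a single pair for each of the first four columns, the unequal pairs for the column `4`.  The
column `5` is given the equal pairs, to which a word with none of these marks is restricted. -/
def carryPairs : Fin 6 → Bool → Bool → Bool
  | 0, a, b => a && b
  | 1, a, b => a && !b
  | 2, a, b => !a && b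
  | 3, a, b => !a && !b
  | 4, a, b => a ^^ b
  | 5, a, b => !(a ^^ b)

/-- The states `0` and `1` are the initial ones for `CarryOut`: no carry into the first two sums. -/
theorem verify_columns (k : Fin 6) : verifyPatterns (fun t => carryPairs k (bit 2 t) (bit 1 t))
    (elements k.castSucc ++ elements 5)
    (fun S matched => (S.testBit 0 || S.testBit 1) == !matched.any id) = true := by
  revert k
  decide +kernel

/-- The elements of the columns `k` and `5` describe the words none of whose runs ends with a pair
of carries belonging to the column `k`.  Column `5` itself describes the words without any runs:
a word that has runs has one that ends with `a = b`. -/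
theorem exists_carryOut_iff (k : Fin 6) {w : List (Fin 8)} (hw : w ≠ []) :
    (∃ a b c, carryPairs k a b = true ∧ CarryOut w a b c) ↔
      ¬ (InColumn k.castSucc w ∨ InColumn 5 w) := by
  have h := good_of_verifyPatterns (verify_columns k) hw
  rw [beq_iff_eq, Bool.eq_iff_iff, Bool.or_eq_true, Bool.not_eq_true', ← Bool.not_eq_true] at h
  have h0 := testBit_foldl_encode w (fun t => carryPairs k (bit 2 t) (bit 1 t))
    (octal false false false)
  have h1 := testBit_foldl_encode w (fun t => carryPairs k (bit 2 t) (bit 1 t))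
    (octal false false true)
  have e : (∃ a b c, carryPairs k a b = true ∧ CarryOut w a b c) ↔
      (∃ t, Reach w (octal false false false) t ∧ carryPairs k (bit 2 t) (bit 1 t) = true) ∨
        ∃ t, Reach w (octal false false true) t ∧ carryPairs k (bit 2 t) (bit 1 t) = true := by
    simp only [CarryOut]
    constructor
    · rintro ⟨_, _, c, hk, t, ht, rfl, rfl⟩
      cases c
      · exact Or.inl ⟨t, ht, hk⟩
      · exact Or.inr ⟨t, ht, hk⟩
    · rintro (⟨t, ht, hk⟩ | ⟨t, ht, hk⟩)
      · exact ⟨_, _, _, hk, t, ht, rfl, rfl⟩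
      · exact ⟨_, _, _, hk, t, ht, rfl, rfl⟩
  rw [e, ← h0, ← h1]
  refine h.trans (not_congr ?_)
  simp [InColumn]


theorem verify_parity : verifyPatterns (fun _ => true) (elements 6) (fun S matched =>
      (!S.testBit 0 || !matched.any id) && (!S.testBit 1 || matched.any id)) = true := by
  decide +kernel

/-- The parity of the least significant symbol determines the initial carry. -/
theorem CarryOut.eq_true_iff {w : List (Fin 8)} (hw : w ≠ []) {a b c : Bool}
    (h : CarryOut w a b c) : c = true ↔ InColumn 6 w := by
  have hg := good_of_verifyPatterns verify_parity hw
  obtain ⟨t, ht, -⟩ := h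
  have hc := (testBit_foldl_encode w (fun _ => true) (octal false false c)).2 ⟨t, ht, rfl⟩
  simp only [Bool.and_eq_true, Bool.or_eq_true, Bool.not_eq_true', ← Bool.not_eq_true] at hg
  cases c
  · simpa [InColumn] using hg.1.resolve_left (not_not.2 hc)
  · simpa [InColumn] using hg.2.resolve_left (not_not.2 hc)

/-- How the truth values `mₖ` of the seven marks of a word determine the set `S` of the states from
which the carry `c` out of the third sum is reached, and which marks exclude or imply others. -/
def marksGood (c : Bool) (S : ℕ) : List Bool → Bool
  | [m₀, m₁, m₂, m₃, m₄, m₅, m₆] =>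
    m₅ && !(m₀ && m₃) && !(m₁ && m₂) && !(m₀ && m₄) && !(m₃ && m₄) && (!m₁ || m₄) &&
      (!m₂ || m₄) &&
      (S.testBit (octal true true false) == (!m₃ && !m₄ && !(c && m₆))) &&
      (S.testBit (octal true false false) == (!m₂ && m₄ && !(c && m₆))) &&
      (S.testBit (octal false true false) == (!m₁ && m₄ && !(c && m₆))) &&
      (S.testBit (octal false false false) == (!m₀ && !m₄ && !(c && m₆)))
  | _ => false

theorem verify_marks (c : Bool) : verifyPatterns (fun t => bit 0 t == c)
    (zeroTable.map Prod.fst) (marksGood c) = true := by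
  revert c
  decide +kernel

/-- The word satisfies the mark of the column `k`. -/
def Marked (k : Fin 7) (w : List (Fin 8)) : Prop := Satisfies w (zeroTable.get (k.cast rfl)).1

/-- The mark of the column `6` excludes the carry `c = 1`; the marks of the columns `0`, `1`, `2`,
`3` each leave a single pair of carries `a`, `b`; and the mark of the column `4` leaves the pairs
with `a ≠ b`. -/
theorem carryIn_iff {w : List (Fin 8)} (hw : w ≠ []) (c : Bool) :
    (CarryIn w true true c ↔ ¬ Marked 3 w ∧ ¬ Marked 4 w ∧ ¬ (c = true ∧ Marked 6 w)) ∧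
    (CarryIn w true false c ↔ ¬ Marked 2 w ∧ Marked 4 w ∧ ¬ (c = true ∧ Marked 6 w)) ∧
    (CarryIn w false true c ↔ ¬ Marked 1 w ∧ Marked 4 w ∧ ¬ (c = true ∧ Marked 6 w)) ∧
    (CarryIn w false false c ↔ ¬ Marked 0 w ∧ ¬ Marked 4 w ∧ ¬ (c = true ∧ Marked 6 w)) ∧
    Marked 5 w ∧ ¬ (Marked 0 w ∧ Marked 3 w) ∧ ¬ (Marked 1 w ∧ Marked 2 w) ∧
    ¬ (Marked 0 w ∧ Marked 4 w) ∧ ¬ (Marked 3 w ∧ Marked 4 w) ∧ (Marked 1 w → Marked 4 w) ∧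
    (Marked 2 w → Marked 4 w) := by
  classical
  have h : marksGood c (w.foldl pre (encode fun t => bit 0 t == c)) [decide (Marked 0 w),
      decide (Marked 1 w), decide (Marked 2 w), decide (Marked 3 w), decide (Marked 4 w),
      decide (Marked 5 w), decide (Marked 6 w)] = true := by
    convert good_of_verifyPatterns (verify_marks c) hw
    rfl
  have hc (a b : Bool) : CarryIn w a b c ↔
      (w.foldl pre (encode fun t => bit 0 t == c)).testBit (octal a b false) = true := by
    simp [testBit_foldl_encode, CarryIn]
  rw [hc, hc, hc, hc]
  have hbeq (x y : Bool) : (x == y) = true ↔ (x = true ↔ y = true) := by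
    rw [beq_iff_eq, Bool.eq_iff_iff]
  have hnot (x : Bool) : (!x) = true ↔ ¬ x = true := by simp
  simp only [marksGood, Bool.and_eq_true, Bool.or_eq_true, hbeq, hnot, decide_eq_true_eq] at h
  obtain ⟨⟨⟨⟨⟨⟨⟨⟨⟨⟨h5, h03⟩, h12⟩, h04⟩, h34⟩, h14⟩, h24⟩, h11⟩, h10⟩, h01⟩, h00⟩ := h
  exact ⟨h11.trans and_assoc, h10.trans and_assoc, h01.trans and_assoc, h00.trans and_assoc, h5,
    h03, h12, h04, h34, imp_iff_not_or.2 h14, imp_iff_not_or.2 h24⟩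

theorem satisfiesTable_iff (w w' : List (Fin 8)) :
    SatisfiesTable w w' ↔ ∃ k : Fin 7, Marked k w' ∧ InColumn k w := by
  constructor
  · rintro ⟨X, hX, hm, hY⟩
    obtain ⟨k, rfl⟩ := List.get_of_mem hX
    exact ⟨k, hm, hY⟩
  · rintro ⟨k, hm, hY⟩
    exact ⟨_, List.get_mem _ _, hm, hY⟩

/-- Two nonempty words admit no pair of runs that exchange carries if and only if they satisfy the
table. -/
theorem forall_carryOut_not_carryIn_iff {w w' : List (Fin 8)} (hw : w ≠ []) (hw' : w' ≠ []) :
    (∀ a b c, CarryOut w a b c → ¬ CarryIn w' a b c) ↔ SatisfiesTable w w' := by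
  classical
  -- The parity of `w` fixes the only carry `c` that can occur.
  have hc {a b c} (h : CarryOut w a b c) : c = decide (InColumn 6 w) := by
    rw [Bool.eq_iff_iff, h.eq_true_iff hw, decide_eq_true_iff]
  have hk (k : Fin 6) : (∃ a b, carryPairs k a b = true ∧ CarryOut w a b (decide (InColumn 6 w))) ↔
      ¬ (InColumn k.castSucc w ∨ InColumn 5 w) := by
    rw [← exists_carryOut_iff k hw]
    constructor
    · rintro ⟨a, b, h⟩
      exact ⟨a, b, _, h⟩
    · rintro ⟨a, b, c, h, h'⟩
      exact ⟨a, b, h, hc h' ▸ h'⟩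
  have h0 := hk 0
  have h1 := hk 1
  have h2 := hk 2
  have h3 := hk 3
  have h4 := hk 4
  have h5 := hk 5
  have hin := carryIn_iff hw' (decide (InColumn 6 w))
  have hall : (∀ a b c, CarryOut w a b c → ¬ CarryIn w' a b c) ↔ ∀ a b,
      CarryOut w a b (decide (InColumn 6 w)) → ¬ CarryIn w' a b (decide (InColumn 6 w)) :=
    ⟨fun h a b => h a b _, fun h a b c hab => hc hab ▸ h a b (hc hab ▸ hab)⟩
  rw [hall, satisfiesTable_iff]
  simp only [Fin.exists_fin_succ, Bool.forall_bool]
  simp [carryPairs, -not_or] at h0 h1 h2 h3 h4 h5 hin ⊢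
  obtain ⟨i11, i10, i01, i00, m5, hm⟩ := hin
  rw [h1, h2] at h4
  rw [h0, h3] at h5
  rw [h0, h1, h2, h3, i11, i10, i01, i00]
  clear hk hc hall h0 h1 h2 h3 i11 i10 i01 i00
  grind

end ImpossibleXR

theorem mainTheorem1 (n r m : ℕ) (hr : 1 ≤ r) (hm : 1 ≤ m) (hn : n = r + m)
    (α β γ : BitVec m) (α' β' γ' : BitVec r) :
    ImpossibleXR.adpXR r ((α' ++ α).cast hn.symm) ((β' ++ β).cast hn.symm)
        ((γ ++ γ').cast ((Nat.add_comm m r).trans hn.symm)) = 0 ↔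
      ImpossibleXR.SatisfiesTable (ImpossibleXR.octalWord α β γ)
        (ImpossibleXR.octalWord α' β' γ') := by
  subst hn
  have hne {k : ℕ} (hk : 1 ≤ k) (x y z : BitVec k) : ImpossibleXR.octalWord x y z ≠ [] := by
    rw [ImpossibleXR.octalWord, ne_eq, List.ofFn_eq_nil_iff]
    omega
  rw [← ImpossibleXR.forall_carryOut_not_carryIn_iff (hne hm α β γ) (hne hr α' β' γ'),
    ← ImpossibleXR.adpXR_eq_zero_iff_carries]
  rfl
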